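/- Let $G$ be a finite group of odd order, let $p$ be a prime, and suppose that $G = HV$ with $H \cap V = 1$, where $V$ is a normal elementary abelian $p$-subgroup of $G$ and $H$ is a nontrivial abelian subgroup whose conjugation action on $V$, viewed as a vector space over $\mathbb{Z}/p$, is faithful and irreducible. Let $k$ be a subfield of $\mathbb{C}$ that contains the primitive $p$-th roots of unity, and let $t$ be the least common multiple of the orders of those roots of unity in $k$ whose order divides $|H|$. Let $\mathrm{acd}_k(G)$ denote the average of the degrees $\chi(1)$, where $\chi$ runs over the complex irreducible characters of $G$ all of whose values lie in $k$. Then $G$ is a Frobenius group with kernel $V$ and complement $H$, and: 1. $\mathrm{acd}_k(G) \ge \frac{3(p+2)}{p+8}$ if $p \equiv 1 \pmod 3$ and $3 \mid t$; 2. $\mathrm{acd}_k(G) \ge \frac{3(p^2+2)}{p^2+8}$ if $p \equiv 2 \pmod 3$, $\frac{p-1}{2} \nmid t$ and $3 \mid t$; 3. $\mathrm{acd}_k(G) \ge \frac{3(p-1)}{p+3}$ if $p \equiv 2 \pmod 3$ and $\frac{p-1}{2} \mid t$; 4. $\mathrm{acd}_k(G) \ge \frac{3p}{p+2}$ if $p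 \equiv 1 \pmod 3$ and $3 \nmid t$; 5. $\mathrm{acd}_k(G) \ge \frac{3p^2}{p^2+2}$ if $p \equiv 2 \pmod 3$, $\frac{p-1}{2} \nmid t$ and $3 \nmid t$. -/

import Mathlib

namespace AvgCharDegree

/-- `V` is an elementary abelian `p`-group. -/
def IsElementaryAbelian {G : Type*} [Group G] (p : ℕ) (V : Subgroup G) : Prop :=
  (∀ x ∈ V, ∀ y ∈ V, x * y = y * x) ∧ ∀ x ∈ V, x ^ p = 1

/-- The conjugation action of `H` on `V` is faithful. -/
def ActsFaithfully {G : Type*} [Group G] (H V : Subgroup G) : Prop :=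
  ∀ h ∈ H, (∀ v ∈ V, h * v * h⁻¹ = v) → h = 1

/-- The conjugation action of `H` on `V` is irreducible. For an elementary abelian `p`-group `V`,
viewed as a vector space over `ℤ/p`, the subspaces of `V` are exactly its subgroups, so this says
that `V` is an irreducible module for `H` over `ℤ/p`. -/
def ActsIrreducibly {G : Type*} [Group G] (H V : Subgroup G) : Prop :=
  V ≠ ⊥ ∧ ∀ W : Subgroup G, W ≤ V → (∀ h ∈ H, ∀ w ∈ W, h * w * h⁻¹ ∈ W) → W = ⊥ ∨ W = V

/-- `G` is a Frobenius group with complement `H` and kernel `N`: `H` is a nontrivial proper subgroup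
that meets each of its conjugates `g H g⁻¹` with `g ∉ H` trivially, and `N` consists of `1` and
the elements of `G` that lie in no conjugate of `H`. -/
def IsFrobeniusGroup {G : Type*} [Group G] (H N : Subgroup G) : Prop :=
  H ≠ ⊥ ∧ H ≠ ⊤ ∧
  (∀ g : G, g ∉ H → ∀ x ∈ H, g * x * g⁻¹ ∈ H → x = 1) ∧
  (∀ x : G, x ∈ N ↔ x = 1 ∨ ∀ g : G, g * x * g⁻¹ ∉ H)

/-- The complex irreducible characters of `G`. -/
def Irr (G : Type*) [Group G] : Set (G → ℂ) :=
  {χ | ∃ (n : ℕ) (ρ : Representation ℂ G (Fin n → ℂ)), ρ.IsIrreducible ∧ χ = ρ.character}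

/-- The complex irreducible characters of `G` all of whose values lie in `k`. -/
def IrrK (k : Subfield ℂ) (G : Type*) [Group G] : Set (G → ℂ) :=
  {χ | χ ∈ Irr G ∧ ∀ g : G, χ g ∈ k}

/-- The average of the degrees `χ 1` of the `k`-valued irreducible characters `χ` of a finite
group `G`. A degree is a natural number, so taking the real part only changes its type. -/
noncomputable def acd (k : Subfield ℂ) (G : Type*) [Group G] : ℝ :=
  (∑ᶠ χ ∈ IrrK k G, (χ 1).re) / (IrrK k G).ncard

open Classical in
/-- The least common multiple of the orders of the roots of unity in `k` whose order divides
`n` (for `n ≠ 0`). -/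
noncomputable def rootOrderLcm (k : Subfield ℂ) (n : ℕ) : ℕ :=
  (n.divisors.filter fun d => ∃ ζ ∈ k, orderOf ζ = d).lcm id

end AvgCharDegree

/-! For `h ∈ H`, the centralizer of `h` in `V` is `H`-invariant because `H` is abelian, so
irreducibility and faithfulness make it trivial when `h ≠ 1` (`eq_one_of_fixed`). Hence `v ↦ h v h⁻¹
v⁻¹` permutes the finite set `V` (`exists_conj_mul_inv_eq`). This gives the Frobenius property, and
it shows that `H` acts freely on the nontrivial linear characters of `V`.

By Clifford theory, `Irr G` consists of the linear characters of `H`, inflated, and of `N`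
characters of degree `m = |H|` induced from `V`, with `N * m + 1 = |V| = p ^ n` (`mem_Irr_iff`,
`ncard_inducedChars_mul`). The induced characters take values in `k`, since `k` contains the `p`-th
roots of unity. So the average is `(L + N * m) / (L + N)`, where `L` counts the `k`-valued linear
characters of `H` (`acd_eq`).

What remains is arithmetic (`avg_bounds`). The inputs are: `N` is even, `L ∣ m`, `t ∣ m`, every
prime dividing `L` divides `t`, and for `n = 1` the group `H` is cyclic, so that `L = m` forces `m ∣
t`. -/

namespace AvgCharDegree

/-! ### Irreducible, one-dimensional and commutative representations. -/

section Irreducible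

variable {G : Type*} [Group G]

theorem isIrreducible_iff {W : Type*} [AddCommGroup W] [Module ℂ W] (ρ : Representation ℂ G W) :
    ρ.IsIrreducible ↔ Nontrivial W ∧
      ∀ U : Submodule ℂ W, (∀ g, ∀ w ∈ U, ρ g w ∈ U) → U = ⊥ ∨ U = ⊤ := by
  constructor
  · intro h
    refine ⟨?_, fun U hU => ?_⟩
    · by_contra hW
      rw [not_nontrivial_iff_subsingleton] at hW
      obtain ⟨x, y, hxy⟩ := h.exists_pair_ne
      exact hxy (Subrepresentation.toSubmodule_injective (Subsingleton.elim _ _))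
    · rcases h.eq_bot_or_eq_top ⟨U, fun g w hw => hU g w hw⟩ with h | h
      · exact Or.inl (congrArg Subrepresentation.toSubmodule h)
      · exact Or.inr (congrArg Subrepresentation.toSubmodule h)
  · rintro ⟨hW, h⟩
    refine { exists_pair_ne := ⟨⊥, ⊤, fun h => ?_⟩, eq_bot_or_eq_top := fun U => ?_ }
    · exact bot_ne_top (α := Submodule ℂ W) (congrArg Subrepresentation.toSubmodule h)
    · rcases h U.toSubmodule (fun g w hw => U.apply_mem_toSubmodule g hw) with h | h
      · exact Or.inl (Subrepresentation.toSubmodule_injective h)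
      · exact Or.inr (Subrepresentation.toSubmodule_injective h)

theorem character_mem_Irr {W : Type*} [AddCommGroup W] [Module ℂ W] [FiniteDimensional ℂ W]
    (ρ : Representation ℂ G W) (hρ : ρ.IsIrreducible) : ρ.character ∈ Irr G := by
  let e : W ≃ₗ[ℂ] (Fin (Module.finrank ℂ W) → ℂ) := (Module.finBasis ℂ W).equivFun
  let ρ' : Representation ℂ G (Fin (Module.finrank ℂ W) → ℂ) :=
    { toFun := fun g => e.conj (ρ g)
      map_one' := by ext; simp [LinearEquiv.conj_apply]
      map_mul' := fun a b => by ext; simp [LinearEquiv.conj_apply] }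
  have hρ' : ∀ g w, ρ' g (e w) = e (ρ g w) := fun g w => by
    simp [ρ', LinearEquiv.conj_apply]
  rw [isIrreducible_iff] at hρ
  obtain ⟨hW, h⟩ := hρ
  refine ⟨_, ρ', (isIrreducible_iff ρ').2 ⟨e.symm.toEquiv.nontrivial, fun U hU => ?_⟩, ?_⟩
  · have := h (U.comap e.toLinearMap) fun g w hw => by
      simpa [hρ'] using hU g _ hw
    rcases this with h | h
    · left
      rw [eq_bot_iff]
      intro x hx
      have : e.symm x ∈ U.comap e.toLinearMap := by simpa using hx
      rw [h] at this
      simpa using this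
    · right
      rw [eq_top_iff]
      intro x _
      have : e.symm x ∈ U.comap e.toLinearMap := by rw [h]; trivial
      simpa using this
  · ext g
    exact (LinearMap.trace_conj' (ρ g) e).symm

/-- A homomorphism to `ℂˣ` as a one-dimensional representation. -/
def linearRep (μ : G →* ℂˣ) : Representation ℂ G ℂ where
  toFun g := (μ g : ℂ) • LinearMap.id
  map_one' := by ext; simp
  map_mul' a b := by ext; simp [mul_comm]

theorem linearRep_character (μ : G →* ℂˣ) (g : G) : (linearRep μ).character g = μ g := by
  simp [Representation.character, linearRep]

theorem linearRep_isIrreducible (μ : G →* ℂˣ) : (linearRep μ).IsIrreducible := by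
  rw [isIrreducible_iff]
  exact ⟨inferInstance, fun U _ => eq_bot_or_eq_top (α := Ideal ℂ) U⟩

theorem coe_hom_mem_Irr (μ : G →* ℂˣ) : (fun g => (μ g : ℂ)) ∈ Irr G := by
  have := character_mem_Irr _ (linearRep_isIrreducible μ)
  rwa [show (linearRep μ).character = fun g => (μ g : ℂ) from
    funext (linearRep_character μ)] at this

/-- A one-dimensional representation is given by a homomorphism to `ℂˣ`. -/
theorem exists_hom_of_finrank_eq_one {W : Type*} [AddCommGroup W] [Module ℂ W]
    (ρ : Representation ℂ G W) (h : Module.finrank ℂ W = 1) :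
    ∃ μ : G →* ℂˣ, ∀ g w, ρ g w = (μ g : ℂ) • w := by
  obtain ⟨v, hv, hspan⟩ := finrank_eq_one_iff'.1 h
  choose c hc using fun g => hspan (ρ g v)
  have key : ∀ g w, ρ g w = c g • w := by
    intro g w
    obtain ⟨a, rfl⟩ := hspan w
    rw [map_smul, ← hc, smul_comm]
  let f : G →* ℂ :=
    { toFun := c
      map_one' := by
        have := key 1 v
        rw [map_one, Module.End.one_apply] at this
        exact (smul_left_injective ℂ hv (by simpa using this)).symm
      map_mul' := fun a b => by
        refine smul_left_injective ℂ hv ?_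
        have := key (a * b) v
        simp only [map_mul, Module.End.mul_apply, key, smul_smul] at this
        exact this.symm }
  exact ⟨f.toHomUnits, fun g w => key g w⟩

/-- A commutative group acting on a nonzero finite-dimensional complex space has a common
eigenvector. -/
theorem exists_common_eigenvector {B W : Type*} [CommGroup B] [Finite B] [AddCommGroup W]
    [Module ℂ W] (ρ : Representation ℂ B W) (w : W) (hw : w ≠ 0) :
    ∃ (l : B →* ℂˣ) (v : W), v ≠ 0 ∧ ∀ b, ρ b v = (l b : ℂ) • v := by
  classical
  have := Fintype.ofFinite B
  have : Finite (B →* ℂˣ) := Nat.finite_of_card_ne_zero (by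
    rw [CommGroup.card_monoidHom_of_hasEnoughRootsOfUnity B ℂ]; exact Nat.card_pos.ne')
  have := Fintype.ofFinite (B →* ℂˣ)
  by_contra! hcon
  -- The projection of `w` to the `l`-eigenspace vanishes if there is no eigenvector. By
  -- orthogonality these projections add up to `|B| • w`, which is nonzero.
  have hproj : ∀ l : B →* ℂˣ, ∑ b : B, ((l b)⁻¹ : ℂ) • ρ b w = 0 := by
    intro l
    by_contra hne
    obtain ⟨b, hb⟩ := hcon l _ hne
    apply hb
    rw [map_sum, Finset.smul_sum]
    refine Fintype.sum_equiv (Equiv.mulLeft b) _ _ fun c => ?_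
    have h1 : ((l b : ℂˣ) : ℂ) ≠ 0 := (l b).ne_zero
    simp only [map_smul, Equiv.coe_mulLeft, map_mul, Module.End.mul_apply, smul_smul,
      Units.val_mul]
    congr 1
    field_simp
  have hsum : ∑ l : B →* ℂˣ, ∑ b : B, ((l b)⁻¹ : ℂ) • ρ b w = 0 :=
    Finset.sum_eq_zero fun l _ => hproj l
  rw [Finset.sum_comm] at hsum
  simp only [← Finset.sum_smul] at hsum
  have horth : ∀ b : B, b ≠ 1 → ∑ l : B →* ℂˣ, ((l b)⁻¹ : ℂ) = 0 := by
    intro b hb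
    obtain ⟨φ, hφ⟩ := CommGroup.exists_apply_ne_one_of_hasEnoughRootsOfUnity B ℂ hb
    have h : ∑ l : B →* ℂˣ, ((l b)⁻¹ : ℂ) = (φ b : ℂ)⁻¹ * ∑ l : B →* ℂˣ, ((l b)⁻¹ : ℂ) := by
      rw [Finset.mul_sum]
      refine (Fintype.sum_equiv (Equiv.mulLeft φ) _ _ fun c => ?_).symm
      simp [mul_comm]
    have h2 : (1 - (φ b : ℂ)⁻¹) * ∑ l : B →* ℂˣ, ((l b)⁻¹ : ℂ) = 0 := by linear_combination h
    refine (mul_eq_zero.1 h2).resolve_left fun h3 => hφ ?_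
    have : (φ b : ℂ)⁻¹ = 1 := by linear_combination -h3
    exact Units.ext (by simpa using this)
  rw [Finset.sum_eq_single 1 (fun b _ hb => by rw [horth b hb, zero_smul]) (by simp)] at hsum
  simp at hsum
  exact hw hsum

end Irreducible

/-! ### Representations of a split extension induced from the kernel. -/

section Split

variable {G A : Type*} [Group G] [CommGroup A] {π : G →* A} {s : A →* G}

/-- The character `v ↦ l (a v a⁻¹)` of `π.ker`. -/
def conjChar (s : A →* G) (l : π.ker →* ℂˣ) (a : A) : π.ker →* ℂˣ :=
  l.comp (MulAut.conjNormal (s a)).toMonoidHom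

theorem conjChar_apply (l : π.ker →* ℂˣ) (a : A) (v : π.ker) :
    conjChar s l a v = l (MulAut.conjNormal (s a) v) := rfl

theorem conjChar_mul (l : π.ker →* ℂˣ) (a b : A) :
    conjChar s (conjChar s l a) b = conjChar s l (a * b) := by
  ext v
  simp [conjChar_apply]

theorem conjChar_one (l : π.ker →* ℂˣ) : conjChar s l 1 = l := by
  ext v
  simp [conjChar_apply]

theorem conjChar_ne_one {l : π.ker →* ℂˣ} (hl : l ≠ 1) (a : A) : conjChar s l a ≠ 1 := by
  intro h
  apply hl
  rw [← conjChar_one (s := s) l, ← mul_inv_cancel a, ← conjChar_mul, h]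
  ext v
  simp [conjChar_apply]

/-- The kernel component of `s a * g`. -/
def kerPart (hs : ∀ a, π (s a) = a) (a : A) (g : G) : π.ker :=
  ⟨s a * g * (s (a * π g))⁻¹, by simp [MonoidHom.mem_ker, hs]⟩

/-- The representation induced from the character `l` of `π.ker`, on functions on the
complement `A`. -/
def monomialRep (hs : ∀ a, π (s a) = a) (l : π.ker →* ℂˣ) : Representation ℂ G (A → ℂ) where
  toFun g :=
    { toFun := fun f a => (l (kerPart hs a g) : ℂ) * f (a * π g)
      map_add' := fun f f' => by ext a; simp [mul_add]
      map_smul' := fun c f => by ext a; simp [mul_left_comm] }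
  map_one' := by
    ext f a
    have : kerPart hs a 1 = 1 := Subtype.ext (by simp [kerPart])
    simp [this]
  map_mul' g g' := by
    apply LinearMap.ext
    intro f
    ext a
    -- The cocycle identity, from moving `s a` past `g` and then past `g'`.
    have : kerPart hs a (g * g') = kerPart hs a g * kerPart hs (a * π g) g' :=
      Subtype.ext (by simp [kerPart, mul_assoc])
    simp [this, mul_assoc]

variable (hs : ∀ a, π (s a) = a)

theorem monomialRep_apply (l : π.ker →* ℂˣ) (g : G) (f : A → ℂ) (a : A) :
    monomialRep hs l g f a = (l (kerPart hs a g) : ℂ) * f (a * π g) := rfl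

theorem monomialRep_apply_ker (l : π.ker →* ℂˣ) (v : π.ker) (f : A → ℂ) (a : A) :
    monomialRep hs l v f a = (conjChar s l a v : ℂ) * f a := by
  have h : π v = 1 := v.2
  rw [monomialRep_apply, h, mul_one, conjChar_apply]
  congr 3
  exact Subtype.ext (by simp [kerPart, h])

theorem monomialRep_apply_section (l : π.ker →* ℂˣ) (b : A) (f : A → ℂ) (a : A) :
    monomialRep hs l (s b) f a = f (a * b) := by
  rw [monomialRep_apply, hs]
  have : kerPart hs a (s b) = 1 := Subtype.ext (by simp [kerPart, hs])
  simp [this]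

theorem conjChar_injective (hfree : ∀ (l : π.ker →* ℂˣ) (a : A), conjChar s l a = l → l = 1 ∨ a = 1)
    {l : π.ker →* ℂˣ} (hl : l ≠ 1) : Function.Injective (conjChar s l) := by
  intro a b hab
  have h : conjChar s l (a * b⁻¹) = l := by
    rw [← conjChar_mul, hab, conjChar_mul, mul_inv_cancel, conjChar_one]
  exact mul_inv_eq_one.1 ((hfree l _ h).resolve_left hl)

theorem sum_hom_eq_zero {B : Type*} [Group B] [Fintype B] {l : B →* ℂˣ} (hl : l ≠ 1) :
    ∑ b, (l b : ℂ) = 0 := by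
  obtain ⟨c, hc⟩ : ∃ c, l c ≠ 1 := by
    by_contra! h
    exact hl (MonoidHom.ext h)
  have h : ∑ b, (l b : ℂ) = (l c : ℂ) * ∑ b, (l b : ℂ) := by
    rw [Finset.mul_sum]
    exact (Fintype.sum_equiv (Equiv.mulLeft c) _ _ fun b => by simp).symm
  have h2 : (1 - (l c : ℂ)) * ∑ b, (l b : ℂ) = 0 := by linear_combination h
  refine (mul_eq_zero.1 h2).resolve_left fun h3 => hc (Units.ext ?_)
  rw [Units.val_one]
  linear_combination -h3

variable [Fintype A]

open Classical in
theorem monomialRep_character (l : π.ker →* ℂˣ) (g : G) :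
    (monomialRep hs l).character g =
      if h : g ∈ π.ker then ∑ a : A, (conjChar s l a ⟨g, h⟩ : ℂ) else 0 := by
  rw [Representation.character, LinearMap.trace_eq_matrix_trace ℂ (Pi.basisFun ℂ A),
    Matrix.trace]
  simp only [Matrix.diag_apply, LinearMap.toMatrix_apply, Pi.basisFun_repr, Pi.basisFun_apply]
  split_ifs with h
  · refine Finset.sum_congr rfl fun a _ => ?_
    have := monomialRep_apply_ker hs l ⟨g, h⟩ (Pi.single a 1) a
    simpa using this
  · refine Finset.sum_eq_zero fun a _ => ?_
    rw [monomialRep_apply, Pi.single_eq_of_ne, mul_zero]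
    intro h'
    exact h (by simpa [MonoidHom.mem_ker] using h')

theorem monomialRep_isIrreducible [Finite G]
    (hfree : ∀ (l : π.ker →* ℂˣ) (a : A), conjChar s l a = l → l = 1 ∨ a = 1)
    {l : π.ker →* ℂˣ} (hl : l ≠ 1) : (monomialRep hs l).IsIrreducible := by
  classical
  have := Fintype.ofFinite π.ker
  rw [isIrreducible_iff]
  refine ⟨inferInstance, fun U hU => or_iff_not_imp_left.2 fun hne => ?_⟩
  obtain ⟨f, hfU, hf⟩ := U.ne_bot_iff.1 hne
  obtain ⟨a, ha⟩ := Function.ne_iff.1 hf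
  -- The point masses are eigenvectors of the kernel for the pairwise distinct characters `conjChar
  -- s l b`. Projecting `f` to the one at `a` isolates its nonzero coordinate there.
  have h1 : (Pi.single a 1 : A → ℂ) ∈ U := by
    have hmem : ∑ v : π.ker, ((conjChar s l a v)⁻¹ : ℂ) • monomialRep hs l v f ∈ U :=
      U.sum_mem fun v _ => U.smul_mem _ (hU _ _ hfU)
    have heq : ∑ v : π.ker, ((conjChar s l a v)⁻¹ : ℂ) • monomialRep hs l v f =
        ((Fintype.card π.ker : ℂ) * f a) • (Pi.single a 1 : A → ℂ) := by
      ext b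
      simp only [Finset.sum_apply, Pi.smul_apply, monomialRep_apply_ker, smul_eq_mul]
      by_cases hb : b = a
      · subst hb
        simp
      · rw [Pi.single_eq_of_ne hb, mul_zero]
        have hne : (conjChar s l a)⁻¹ * conjChar s l b ≠ 1 := fun h =>
          hb (conjChar_injective hfree hl (inv_mul_eq_one.1 h)).symm
        have h0 := sum_hom_eq_zero hne
        rw [← mul_eq_zero_of_left h0 (f b), Finset.sum_mul]
        exact Finset.sum_congr rfl fun v _ => by simp [mul_assoc]
    rw [heq] at hmem
    refine (U.smul_mem_iff (mul_ne_zero ?_ ha)).1 hmem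
    exact_mod_cast Fintype.card_ne_zero
  -- The complement permutes the point masses transitively.
  have h2 : ∀ b, (Pi.single b 1 : A → ℂ) ∈ U := by
    intro b
    have := hU (s (b⁻¹ * a)) _ h1
    convert this using 1
    ext c
    rw [monomialRep_apply_section, Pi.single_apply, Pi.single_apply]
    congr 1
    rw [← mul_assoc, mul_eq_right, mul_inv_eq_one]
  rw [eq_top_iff]
  intro x _
  rw [pi_eq_sum_univ' x]
  refine U.sum_mem fun b _ => U.smul_mem _ ?_
  convert h2 b using 1

/-- An irreducible representation containing the nontrivial character `l` of the kernel is
induced from `l`. -/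
theorem character_eq_of_eigenvector [Finite G]
    (hfree : ∀ (l : π.ker →* ℂˣ) (a : A), conjChar s l a = l → l = 1 ∨ a = 1)
    {l : π.ker →* ℂˣ} (hl : l ≠ 1) {W : Type*} [AddCommGroup W] [Module ℂ W]
    (ρ : Representation ℂ G W) (hρ : ρ.IsIrreducible) {w : W} (hw : w ≠ 0)
    (hlw : ∀ v : π.ker, ρ v w = (l v : ℂ) • w) :
    ρ.character = (monomialRep hs l).character := by
  classical
  have := monomialRep_isIrreducible hs hfree hl
  -- The map of Frobenius reciprocity attached to `w`. It sends the point mass at `1` to `w ≠ 0`, so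
  -- by Schur's lemma it is an isomorphism.
  let φ : (A → ℂ) →ₗ[ℂ] W := ∑ a : A, (LinearMap.proj a).smulRight (ρ (s a)⁻¹ w)
  have hφ : ∀ f, φ f = ∑ a : A, f a • ρ (s a)⁻¹ w := fun f => by simp [φ]
  have hint : ∀ g f, φ (monomialRep hs l g f) = ρ g (φ f) := by
    intro g f
    rw [hφ, hφ, map_sum]
    refine Fintype.sum_equiv (Equiv.mulRight (π g)) _ _ fun a => ?_
    rw [monomialRep_apply, Equiv.coe_mulRight, map_smul, ← Module.End.mul_apply, ← map_mul,
      mul_comm, mul_smul]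
    congr 1
    have : g * (s (a * π g))⁻¹ = (s a)⁻¹ * (kerPart hs a g : G) := by simp [kerPart, mul_assoc]
    rw [this, map_mul, Module.End.mul_apply, hlw, map_smul]
  let Φ : Representation.IntertwiningMap (monomialRep hs l) ρ :=
    LinearMap.intertwiningMap_of_isIntertwiningMap _ _ φ hint
  have hΦ : ∀ f, Φ f = φ f := fun f => rfl
  rcases Representation.IsIrreducible.bijective_or_eq_zero Φ with h | h
  · exact (Representation.char_iso (Φ.ofBijective h)).symm
  · exfalso
    apply hw
    have h1 : φ (Pi.single 1 1) = 0 := by rw [← hΦ, h]; rfl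
    simpa [hφ, Pi.single_apply] using h1

end Split

/-! ### The irreducible characters of the split extension and their average degree. -/

section Classification

variable {G A : Type*} [Group G] [CommGroup A] {π : G →* A} {s : A →* G}
  (hs : ∀ a, π (s a) = a)

theorem finite_hom (B : Type*) [Group B] [Finite B] : Finite (B →* ℂˣ) := by
  have : NeZero (Nat.card B) := ⟨Nat.card_pos.ne'⟩
  refine Finite.of_injective
    (fun (l : B →* ℂˣ) (b : B) => (⟨l b, by
      rw [mem_rootsOfUnity, ← map_pow, pow_card_eq_one', map_one]⟩ : rootsOfUnity (Nat.card B) ℂ))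
    fun l l' h => MonoidHom.ext fun b => ?_
  exact congrArg Subtype.val (congrFun h b)

/-- The characters of degree `|A|` induced from the kernel. -/
def inducedChars : Set (G → ℂ) :=
  {χ | ∃ l : π.ker →* ℂˣ, l ≠ 1 ∧ χ = (monomialRep hs l).character}

theorem inducedChars_finite [Finite G] : (inducedChars hs).Finite := by
  have := finite_hom π.ker
  refine (Set.finite_range fun l : π.ker →* ℂˣ => (monomialRep hs l).character).subset ?_
  rintro _ ⟨l, -, rfl⟩
  exact ⟨l, rfl⟩

variable [Fintype A]

theorem monomialRep_character_ker (l : π.ker →* ℂˣ) (v : π.ker) :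
    (monomialRep hs l).character v = ∑ a : A, (conjChar s l a v : ℂ) := by
  simp [monomialRep_character]

theorem monomialRep_character_conjChar (l : π.ker →* ℂˣ) (a : A) :
    (monomialRep hs (conjChar s l a)).character = (monomialRep hs l).character := by
  ext g
  rw [monomialRep_character, monomialRep_character]
  split_ifs with h
  · exact Fintype.sum_equiv (Equiv.mulLeft a) _ _ fun b => by
      rw [conjChar_mul, Equiv.coe_mulLeft]
  · rfl

variable [Finite G]

theorem mem_Irr_iff (hcomm : ∀ x y : π.ker, x * y = y * x)
    (hfree : ∀ (l : π.ker →* ℂˣ) (a : A), conjChar s l a = l → l = 1 ∨ a = 1) (χ : G → ℂ) :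
    χ ∈ Irr G ↔ (∃ μ : A →* ℂˣ, χ = fun g => (μ (π g) : ℂ)) ∨
      ∃ l : π.ker →* ℂˣ, l ≠ 1 ∧ χ = (monomialRep hs l).character := by
  constructor
  · rintro ⟨n, ρ, hρ, rfl⟩
    obtain ⟨hW, hsub⟩ := (isIrreducible_iff ρ).1 hρ
    obtain ⟨w, hw⟩ := exists_ne (0 : Fin n → ℂ)
    let _ : CommGroup π.ker := { (inferInstance : Group π.ker) with mul_comm := hcomm }
    obtain ⟨l, v, hv, hlv⟩ := exists_common_eigenvector (ρ.comp π.ker.subtype) w hw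
    by_cases hl : l = 1
    · left
      -- The vectors fixed by the kernel form a `G`-invariant subspace because the kernel is normal.
      -- It contains `v`, so it is everything and the action factors through `A`.
      let U : Submodule ℂ (Fin n → ℂ) :=
        { carrier := {w | ∀ x : π.ker, ρ x w = w}
          add_mem' := fun {a b} ha hb x => by rw [map_add, ha, hb]
          zero_mem' := fun x => map_zero _
          smul_mem' := fun c a ha x => by rw [map_smul, ha] }
      have hU : U = ⊤ := by
        refine (hsub U fun g w hw x => ?_).resolve_left
          ((Submodule.ne_bot_iff U).2 ⟨v, fun x => ?_, hv⟩)
        · have h := hw ⟨g⁻¹ * x * g, by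
            have hx : π x = 1 := x.2
            simp [MonoidHom.mem_ker, hx]⟩
          nth_rw 2 [← h]
          rw [← Module.End.mul_apply, ← Module.End.mul_apply, ← map_mul, ← map_mul]
          congr 2
          simp [mul_assoc]
        · have := hlv x
          simpa [hl] using this
      have htriv : ∀ (x : π.ker) w, ρ x w = w := fun x w => by
        have : w ∈ U := by rw [hU]; trivial
        exact this x
      have hfac : ∀ g w, ρ g w = ρ (s (π g)) w := fun g w => by
        have := htriv ⟨g * (s (π g))⁻¹, by simp [MonoidHom.mem_ker, hs]⟩ (ρ (s (π g)) w)
        rwa [← Module.End.mul_apply, ← map_mul, inv_mul_cancel_right] at this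
      let σ : Representation ℂ A (Fin n → ℂ) := ρ.comp s
      have hσ : σ.IsIrreducible := (isIrreducible_iff σ).2
        ⟨hW, fun U hU => hsub U fun g w hw => by rw [hfac]; exact hU _ _ hw⟩
      have h1 := Representation.IsIrreducible.finrank_eq_one_of_isMulCommutative σ
      obtain ⟨μ, hμ⟩ := exists_hom_of_finrank_eq_one σ h1
      refine ⟨μ, funext fun g => ?_⟩
      have : ρ g = (μ (π g) : ℂ) • LinearMap.id := LinearMap.ext fun w => by
        rw [hfac]
        exact hμ _ _
      rw [Representation.character, this, map_smul, LinearMap.trace_id, h1]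
      simp
    · exact Or.inr ⟨l, hl, character_eq_of_eigenvector hs hfree hl ρ hρ hv hlv⟩
  · rintro (⟨μ, rfl⟩ | ⟨l, hl, rfl⟩)
    · exact coe_hom_mem_Irr (μ.comp π)
    · exact character_mem_Irr _ (monomialRep_isIrreducible hs hfree hl)

/-- Restricted to the kernel, the induced character is the sum over the `A`-orbit of `l`. Pairing it
with `l'` counts the occurrences of `l'` in that orbit. -/
theorem monomialRep_character_eq_iff
    (hfree : ∀ (l : π.ker →* ℂˣ) (a : A), conjChar s l a = l → l = 1 ∨ a = 1)
    {l l' : π.ker →* ℂˣ} (hl' : l' ≠ 1) :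
    (monomialRep hs l').character = (monomialRep hs l).character ↔ ∃ a, conjChar s l a = l' := by
  classical
  have := Fintype.ofFinite π.ker
  refine ⟨fun h => ?_, ?_⟩
  · by_contra! hcon
    have key : ∀ m : π.ker →* ℂˣ, ∑ v : π.ker, ((l' v)⁻¹ : ℂ) * (monomialRep hs m).character v =
        ∑ a : A, ∑ v : π.ker, (((l'⁻¹ * conjChar s m a) v : ℂˣ) : ℂ) := by
      intro m
      rw [Finset.sum_comm]
      refine Finset.sum_congr rfl fun v _ => ?_
      rw [monomialRep_character_ker, Finset.mul_sum]
      exact Finset.sum_congr rfl fun a _ => by simp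
    have h1 := key l
    rw [Finset.sum_eq_zero fun a _ => sum_hom_eq_zero fun h => hcon a (inv_mul_eq_one.1 h).symm,
      ← h, key l', Finset.sum_eq_single 1] at h1
    · simp [conjChar_one] at h1
    · intro a _ ha
      exact sum_hom_eq_zero fun h => ha ((hfree l' a (inv_mul_eq_one.1 h).symm).resolve_left hl')
    · simp
  · rintro ⟨a, rfl⟩
    exact monomialRep_character_conjChar hs l a

/-- The `|π.ker| - 1` nontrivial characters of the kernel split into free `A`-orbits, and these are
the fibres of induction. -/
theorem ncard_inducedChars_mul (hcomm : ∀ x y : π.ker, x * y = y * x)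
    (hfree : ∀ (l : π.ker →* ℂˣ) (a : A), conjChar s l a = l → l = 1 ∨ a = 1) :
    (inducedChars hs).ncard * Fintype.card A + 1 = Nat.card π.ker := by
  classical
  let _ : CommGroup π.ker := { (inferInstance : Group π.ker) with mul_comm := hcomm }
  have := finite_hom π.ker
  have := Fintype.ofFinite (π.ker →* ℂˣ)
  let X : Finset (π.ker →* ℂˣ) := Finset.univ.erase 1
  let F : (π.ker →* ℂˣ) → (G → ℂ) := fun l => (monomialRep hs l).character
  have hX : X.card + 1 = Nat.card π.ker := by
    rw [Finset.card_erase_add_one (Finset.mem_univ _), Finset.card_univ,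
      ← Nat.card_eq_fintype_card]
    exact CommGroup.card_monoidHom_of_hasEnoughRootsOfUnity π.ker ℂ
  have himg : inducedChars hs = (X.image F : Finset (G → ℂ)) := by
    ext χ
    simp [inducedChars, X, F, eq_comm]
  rw [himg, Set.ncard_coe_finset, ← hX, Finset.card_eq_sum_card_image F X,
    Finset.sum_const_nat (m := Fintype.card A)]
  intro χ hχ
  obtain ⟨l, hl, rfl⟩ := Finset.mem_image.1 hχ
  have hl1 : l ≠ 1 := (Finset.mem_erase.1 hl).1
  have : X.filter (fun l' => F l' = F l) = Finset.univ.image (conjChar s l) := by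
    ext l'
    simp only [Finset.mem_filter, X, Finset.mem_erase, Finset.mem_univ, and_true,
      Finset.mem_image, true_and, F]
    constructor
    · rintro ⟨h1, h2⟩
      exact (monomialRep_character_eq_iff hs hfree h1).1 h2
    · rintro ⟨a, rfl⟩
      exact ⟨conjChar_ne_one hl1 a, monomialRep_character_conjChar hs l a⟩
  rw [this, Finset.card_image_of_injective _ (conjChar_injective hfree hl1), Finset.card_univ]

/-- The characters `A →* ℂˣ` with values in `k`. -/
def valuedHoms (k : Subfield ℂ) (A : Type*) [Group A] : Subgroup (A →* ℂˣ) where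
  carrier := {μ | ∀ a, (μ a : ℂ) ∈ k}
  mul_mem' := fun hμ hν a => by simpa using k.mul_mem (hμ a) (hν a)
  one_mem' := fun a => by simp
  inv_mem' := fun hμ a => by simpa using k.inv_mem (hμ a)

theorem acd_eq (hcomm : ∀ x y : π.ker, x * y = y * x)
    (hfree : ∀ (l : π.ker →* ℂˣ) (a : A), conjChar s l a = l → l = 1 ∨ a = 1)
    (hA : Fintype.card A ≠ 1) (k : Subfield ℂ)
    (hk : ∀ (l : π.ker →* ℂˣ) v, (l v : ℂ) ∈ k) :
    acd k G = ((Nat.card (valuedHoms k A) : ℝ) + (inducedChars hs).ncard * Fintype.card A) /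
      (Nat.card (valuedHoms k A) + (inducedChars hs).ncard) := by
  classical
  let F : (A →* ℂˣ) → (G → ℂ) := fun μ g => (μ (π g) : ℂ)
  have hF : Function.Injective F := fun μ ν h => MonoidHom.ext fun a => Units.ext (by
    have := congrFun h (s a)
    simpa only [F, hs] using this)
  let S : Set (G → ℂ) := F '' (valuedHoms k A : Set (A →* ℂˣ))
  have hSfin : S.Finite := by
    have := finite_hom A
    exact (Set.toFinite _).image F
  have hTfin := inducedChars_finite hs
  have hS1 : ∀ χ ∈ S, (χ 1).re = 1 := by
    rintro _ ⟨μ, -, rfl⟩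
    simp [F]
  have hT1 : ∀ χ ∈ inducedChars hs, (χ 1).re = Fintype.card A := by
    rintro _ ⟨l, -, rfl⟩
    rw [Representation.char_one]
    simp
  -- The degrees `1` and `|A|` differ.
  have hdisj : Disjoint S (inducedChars hs) := by
    rw [Set.disjoint_left]
    intro χ h1 h2
    have := hS1 χ h1
    rw [hT1 χ h2] at this
    exact hA (by exact_mod_cast this)
  have hIrr : IrrK k G = S ∪ inducedChars hs := by
    ext χ
    rw [IrrK, Set.mem_ofPred_eq, mem_Irr_iff hs hcomm hfree]
    constructor
    · rintro ⟨⟨μ, rfl⟩ | h, h2⟩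
      · refine Or.inl ⟨μ, fun a => ?_, rfl⟩
        have := h2 (s a)
        simpa only [hs] using this
      · exact Or.inr h
    · rintro (⟨μ, hμ, rfl⟩ | ⟨l, hl, rfl⟩)
      · exact ⟨Or.inl ⟨μ, rfl⟩, fun g => hμ _⟩
      · refine ⟨Or.inr ⟨l, hl, rfl⟩, fun g => ?_⟩
        rw [monomialRep_character]
        split_ifs
        · exact k.sum_mem fun a _ => hk _ _
        · exact k.zero_mem
  have hScard : S.ncard = Nat.card (valuedHoms k A) := by
    rw [Set.ncard_image_of_injective _ hF, ← Nat.card_coe_set_eq]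
    rfl
  rw [acd, hIrr, finsum_mem_union hdisj hSfin hTfin, Set.ncard_union_eq hdisj hSfin hTfin,
    finsum_mem_congr rfl hS1, finsum_mem_congr rfl hT1, ← hScard]
  have hconst : ∀ (T : Set (G → ℂ)) (hT : T.Finite) (c : ℝ), ∑ᶠ χ ∈ T, c = T.ncard * c := by
    intro T hT c
    rw [finsum_mem_eq_finite_toFinset_sum _ hT, Finset.sum_const, nsmul_eq_mul,
      Set.ncard_eq_toFinset_card T hT]
  rw [hconst S hSfin, hconst _ hTfin]
  push_cast
  ring

end Classification

section Bounds

/-! In this section `L` is the number of linear characters, and `N` the number of characters of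
degree `m`, so that the average degree is `(L + N * m) / (L + N)`. -/

variable {L N m p : ℕ}

/-- The right side grows with `x`, so `x = N * m + 1` is the worst case. The cross-multiplied
difference is then `N` times the quantity in `h2`, which is at least `3 * (m - 3)`. Equality occurs
for `N = 2`, `L = m = 3`, `x = 7`. -/
theorem avg_ge_of_le (hL : L ≤ m) (hm : 3 ≤ m) (hN : 2 ≤ N) {x : ℝ} (hx : 0 ≤ x)
    (hxq : x ≤ N * m + 1) :
    ((L : ℝ) + N * m) / (L + N) ≥ 3 * (x + 2) / (x + 8) := by
  have hL' : (L : ℝ) ≤ m := by exact_mod_cast hL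
  have hm' : (3 : ℝ) ≤ m := by exact_mod_cast hm
  have hN' : (2 : ℝ) ≤ N := by exact_mod_cast hN
  have hL0 : (0 : ℝ) ≤ L := L.cast_nonneg
  have h1 : 3 * (x + 2) / (x + 8) ≤ 3 * ((N : ℝ) * m + 3) / (N * m + 9) := by
    rw [div_le_div_iff₀ (by positivity) (by positivity)]
    linarith
  refine h1.trans ?_
  rw [div_le_div_iff₀ (by positivity) (by positivity)]
  have h2 : 0 ≤ (N : ℝ) * m * (m - 3) + 9 * (m - 1) - 2 * m * L := by
    have h3 : 2 * (m * (m - 3)) ≤ (N : ℝ) * (m * (m - 3)) :=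
      mul_le_mul_of_nonneg_right hN' (mul_nonneg (by linarith) (by linarith))
    have h4 : (m : ℝ) * L ≤ m * m := mul_le_mul_of_nonneg_left hL' (by linarith)
    linarith
  linarith [mul_nonneg (by linarith : (0 : ℝ) ≤ N) h2]

/-- The bound improves because either `3 ∣ m`, and then `3 * L ∣ m`, or `3 ∣ N`, and then `N ≥ 6` by
parity and `m ≥ 5`. -/
theorem avg_ge_of_not_three_dvd (hLm : L ∣ m) (hL : ¬ 3 ∣ L) (hmodd : Odd m) (hm : 3 ≤ m)
    (hNeven : Even N) (hN : 2 ≤ N) (h3 : 3 ∣ N * m) {x : ℝ} (hx : 0 ≤ x) (hxq : x ≤ N * m + 1) :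
    ((L : ℝ) + N * m) / (L + N) ≥ 3 * x / (x + 2) := by
  have hm' : (3 : ℝ) ≤ m := by exact_mod_cast hm
  have hN' : (2 : ℝ) ≤ N := by exact_mod_cast hN
  have hL0 : (0 : ℝ) ≤ L := L.cast_nonneg
  have h1 : 3 * x / (x + 2) ≤ 3 * ((N : ℝ) * m + 1) / (N * m + 3) := by
    rw [div_le_div_iff₀ (by positivity) (by positivity)]
    linarith
  refine h1.trans ?_
  rw [div_le_div_iff₀ (by positivity) (by positivity)]
  have h2 : 0 ≤ (N : ℝ) * m * (m - 3) + 3 * (m - 1) - 2 * m * L := by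
    by_cases h3m : 3 ∣ m
    · have h3L : 3 * L ≤ m := Nat.le_of_dvd (by omega)
        (Nat.Coprime.mul_dvd_of_dvd_of_dvd ((Nat.Prime.coprime_iff_not_dvd Nat.prime_three).2 hL)
          h3m hLm)
      have h3L' : (3 : ℝ) * L ≤ m := by exact_mod_cast h3L
      have h4 : 2 * (m * (m - 3)) ≤ (N : ℝ) * (m * (m - 3)) :=
        mul_le_mul_of_nonneg_right hN' (mul_nonneg (by linarith) (by linarith))
      have h5 : (m : ℝ) * (3 * L) ≤ m * m := mul_le_mul_of_nonneg_left h3L' (by linarith)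
      nlinarith [mul_nonneg (sub_nonneg.2 hm') (by linarith : (0 : ℝ) ≤ 4 * m + 3)]
    · have hm5 : 5 ≤ m := by
        obtain ⟨j, rfl⟩ := hmodd
        omega
      have hN6 : (6 : ℝ) ≤ N := by
        have := (Nat.Prime.dvd_mul Nat.prime_three).1 h3
        obtain ⟨j, rfl⟩ := hNeven
        exact_mod_cast (by omega : 6 ≤ j + j)
      have hL' : (L : ℝ) ≤ m := by exact_mod_cast Nat.le_of_dvd (by omega) hLm
      have hm5' : (5 : ℝ) ≤ m := by exact_mod_cast hm5
      have h4 : 6 * (m * (m - 3)) ≤ (N : ℝ) * (m * (m - 3)) :=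
        mul_le_mul_of_nonneg_right hN6 (mul_nonneg (by linarith) (by linarith))
      have h5 : (m : ℝ) * L ≤ m * m := mul_le_mul_of_nonneg_left hL' (by linarith)
      nlinarith
  linarith [mul_nonneg (by linarith : (0 : ℝ) ≤ N) h2]

theorem avg_ge_of_two_mul_le (hL : L ≤ m) (hm : 5 ≤ m) (hN : 2 ≤ N) {x : ℝ} (hx : 0 ≤ x)
    (hxq : 2 * x ≤ N * m) :
    ((L : ℝ) + N * m) / (L + N) ≥ 3 * x / (x + 2) := by
  have hL' : (L : ℝ) ≤ m := by exact_mod_cast hL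
  have hm' : (5 : ℝ) ≤ m := by exact_mod_cast hm
  have hN' : (2 : ℝ) ≤ N := by exact_mod_cast hN
  have hL0 : (0 : ℝ) ≤ L := L.cast_nonneg
  have h1 : 3 * x / (x + 2) ≤ 3 * ((N : ℝ) * m) / (N * m + 4) := by
    rw [div_le_div_iff₀ (by positivity) (by positivity)]
    linarith
  refine h1.trans ?_
  rw [div_le_div_iff₀ (by positivity) (by positivity)]
  have h2 : 0 ≤ (N : ℝ) * (N - 2) * (m - 5) + 2 * ((N - 1) * (N - 2)) :=
    add_nonneg (mul_nonneg (mul_nonneg (by linarith) (by linarith)) (by linarith))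
      (mul_nonneg (by norm_num) (mul_nonneg (by linarith) (by linarith)))
  have h3 : (0 : ℝ) ≤ (m - L) * (2 * (N * m) - 4) :=
    mul_nonneg (by linarith) (by nlinarith)
  linarith [mul_nonneg (by linarith : (0 : ℝ) ≤ m) h2]

theorem avg_ge_of_eq_two (hL : L ≤ m) (hm : 1 ≤ m) (hp : 2 * m + 1 = p) :
    ((L : ℝ) + (2 : ℕ) * m) / (L + (2 : ℕ)) ≥ 3 * ((p : ℝ) - 1) / (p + 3) := by
  have hL' : (L : ℝ) ≤ m := by exact_mod_cast hL
  have hm' : (1 : ℝ) ≤ m := by exact_mod_cast hm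
  have hL0 : (0 : ℝ) ≤ L := L.cast_nonneg
  subst hp
  push_cast
  rw [ge_iff_le, div_le_div_iff₀ (by positivity) (by positivity)]
  linarith [mul_nonneg (sub_nonneg.2 hL') (sub_nonneg.2 hm')]

/-- The hypothesis says that the average is at least `3`, the supremum of the right side. -/
theorem avg_ge_three (h : 2 * L + 3 * N ≤ N * m) (hN : 0 < N) {x : ℝ} (hx : 0 ≤ x) :
    ((L : ℝ) + N * m) / (L + N) ≥ 3 * x / (x + 2) := by
  have h' : (2 : ℝ) * L + 3 * N ≤ N * m := by exact_mod_cast h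
  have hN' : (0 : ℝ) < N := by exact_mod_cast hN
  have h1 : 3 * x / (x + 2) ≤ 3 := by
    rw [div_le_iff₀ (by positivity)]
    linarith
  refine h1.trans ?_
  rw [le_div_iff₀ (by positivity)]
  linarith

end Bounds

/-- The five bounds, for a prime power `p ^ n = N * m + 1`. -/
theorem avg_bounds {L N m p n t : ℕ} (hp : p.Prime) (hpodd : Odd p) (hn : n ≠ 0) (hm : Odd m)
    (hm1 : m ≠ 1) (hq : N * m + 1 = p ^ n) (hLm : L ∣ m) (htm : t ∣ m) (hL3 : 3 ∣ L → 3 ∣ t)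
    (hcyc : n = 1 → L = m → m ∣ t) :
    (p ≡ 1 [MOD 3] → 3 ∣ t →
      ((L : ℝ) + N * m) / (L + N) ≥ 3 * ((p : ℝ) + 2) / ((p : ℝ) + 8)) ∧
    (p ≡ 2 [MOD 3] → ¬ (p - 1) / 2 ∣ t → 3 ∣ t →
      ((L : ℝ) + N * m) / (L + N) ≥ 3 * ((p : ℝ) ^ 2 + 2) / ((p : ℝ) ^ 2 + 8)) ∧
    (p ≡ 2 [MOD 3] → (p - 1) / 2 ∣ t →
      ((L : ℝ) + N * m) / (L + N) ≥ 3 * ((p : ℝ) - 1) / ((p : ℝ) + 3)) ∧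
    (p ≡ 1 [MOD 3] → ¬ 3 ∣ t →
      ((L : ℝ) + N * m) / (L + N) ≥ 3 * (p : ℝ) / ((p : ℝ) + 2)) ∧
    (p ≡ 2 [MOD 3] → ¬ (p - 1) / 2 ∣ t → ¬ 3 ∣ t →
      ((L : ℝ) + N * m) / (L + N) ≥ 3 * (p : ℝ) ^ 2 / ((p : ℝ) ^ 2 + 2)) := by
  have hm3 : 3 ≤ m := by
    obtain ⟨j, rfl⟩ := hm
    omega
  have hLle : L ≤ m := Nat.le_of_dvd (by omega) hLm
  have hNeven : Even N := by
    have h1 : Odd (N * m + 1) := hq ▸ hpodd.pow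
    have h2 : Even (N * m) := by
      rw [← Nat.not_odd_iff_even]
      exact fun h => (Nat.not_odd_iff_even.2 h.add_one) h1
    exact (Nat.even_mul.1 h2).resolve_right (Nat.not_even_iff_odd.2 hm)
  have hN0 : N ≠ 0 := by
    rintro rfl
    rw [zero_mul, zero_add, eq_comm, Nat.pow_eq_one] at hq
    exact hq.elim hp.one_lt.ne' hn
  have hN2 : 2 ≤ N := by
    obtain ⟨j, rfl⟩ := hNeven
    omega
  have hqR : (N : ℝ) * m + 1 = (p : ℝ) ^ n := by exact_mod_cast hq
  have hp1 : (1 : ℝ) ≤ p := by exact_mod_cast hp.one_lt.le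
  have hpow : ∀ j, j ≤ n → (p : ℝ) ^ j ≤ N * m + 1 := fun j hj => by
    rw [hqR]
    exact pow_le_pow_right₀ hp1 hj
  have hple : (p : ℝ) ≤ N * m + 1 := by simpa using hpow 1 (by omega)
  refine ⟨fun _ _ => avg_ge_of_le hLle hm3 hN2 (by positivity) hple, fun hp2 _ h3t => ?_,
    fun hp2 hdvd => ?_, fun h1 h3t => ?_, fun hp2 hndvd h3t => ?_⟩
  · refine avg_ge_of_le hLle hm3 hN2 (by positivity) (hpow 2 ?_)
    -- If `n = 1`, then `3 ∣ t ∣ m` and `p = N * m + 1` give `p ≡ 1` modulo `3`.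
    by_contra hcon
    obtain rfl : n = 1 := by omega
    obtain ⟨c, hc⟩ := (h3t.trans htm).mul_left N
    rw [hc, pow_one] at hq
    rw [Nat.ModEq] at hp2
    omega
  · by_cases hn1 : n = 1
    · subst hn1
      rw [pow_one] at hq
      have hmle : (p - 1) / 2 ≤ m := Nat.le_of_dvd (by omega) (hdvd.trans htm)
      -- `N ≥ 3` would give `3 * m ≤ p - 1 ≤ 2 * m`.
      have : N = 2 := by
        by_contra hcon
        have : 3 ≤ N := by omega
        have := Nat.mul_le_mul_right m this
        omega
      subst this
      exact avg_ge_of_eq_two hLle (by omega) hq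
    · refine le_trans ?_ (avg_ge_of_le hLle hm3 hN2 (by positivity) (hpow 2 (by omega)))
      have : (2 : ℝ) ≤ p := by exact_mod_cast hp.two_le
      rw [div_le_div_iff₀ (by linarith) (by positivity)]
      nlinarith
  · refine avg_ge_of_not_three_dvd hLm (fun h => h3t (hL3 h)) hm hm3 hNeven hN2 ?_ (by positivity) hple
    have h : p ^ n ≡ 1 ^ n [MOD 3] := h1.pow n
    rw [← hq, one_pow, Nat.ModEq] at h
    omega
  · have hL3' : ¬ 3 ∣ L := fun h => h3t (hL3 h)
    have hp5 : 5 ≤ p := by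
      have := hp.two_le
      obtain ⟨j, rfl⟩ := hpodd
      rw [Nat.ModEq] at hp2
      omega
    rcases Nat.even_or_odd n with hne | hno
    · obtain ⟨j, rfl⟩ := hne
      refine avg_ge_of_not_three_dvd hLm hL3' hm hm3 hNeven hN2 ?_ (by positivity) (hpow 2 (by omega))
      have h : p ^ (j + j) ≡ 1 [MOD 3] := by
        rw [← mul_two, mul_comm, pow_mul]
        have h4 : (p ^ 2) ^ j ≡ (2 ^ 2) ^ j [MOD 3] := (hp2.pow 2).pow j
        have h5 : (2 ^ 2) ^ j ≡ 1 ^ j [MOD 3] := Nat.ModEq.pow j (by decide)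
        simpa using h4.trans h5
      rw [← hq, Nat.ModEq] at h
      omega
    · have h3m : ¬ 3 ∣ N * m := by
        have h : p ^ n ≡ 2 [MOD 3] := by
          obtain ⟨j, rfl⟩ := hno
          rw [pow_succ, pow_mul]
          have h4 : (p ^ 2) ^ j ≡ (2 ^ 2) ^ j [MOD 3] := (hp2.pow 2).pow j
          have h5 : (2 ^ 2) ^ j ≡ 1 ^ j [MOD 3] := Nat.ModEq.pow j (by decide)
          simpa using (h4.trans h5).mul hp2
        rw [← hq, Nat.ModEq] at h
        omega
      have hm5 : 5 ≤ m := by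
        have : ¬ 3 ∣ m := fun h => h3m (h.mul_left N)
        obtain ⟨j, rfl⟩ := hm
        omega
      by_cases hn1 : n = 1
      · subst hn1
        rw [pow_one] at hq
        refine avg_ge_three ?_ (by omega) (by positivity)
        -- For `N = 2`, `m = (p - 1) / 2` does not divide `t`, so `L` is a proper divisor of the odd
        -- number `m` and `3 * L ≤ m`. For `N ≥ 4`, the bound `L ≤ m` suffices except when `N = 4`
        -- and `m = 5`, where `p` would be `21`.
        by_cases hN : N = 2
        · subst hN
          have hne : L ≠ m := fun h => hndvd (by
            have := hcyc rfl h
            rwa [show (p - 1) / 2 = m by omega])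
          obtain ⟨c, rfl⟩ := hLm
          have hc : Odd c := (Nat.odd_mul.1 hm).2
          have hc3 : 3 ≤ c := by
            obtain ⟨j, rfl⟩ := hc
            rcases j with _ | j
            · simp at hne
            · omega
          have := Nat.mul_le_mul_left L hc3
          omega
        · obtain ⟨j, rfl⟩ := hNeven
          rcases hm5.lt_or_eq with h | h
          · have := Nat.mul_le_mul_right m (by omega : 2 ≤ j)
            have := Nat.mul_le_mul_right (m - 3) (by omega : 4 ≤ j + j)
            have h6 : (j + j) * m = (j + j) * (m - 3) + (j + j) * 3 := by
              rw [← mul_add]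
              congr 1
              omega
            omega
          · subst h
            have : j ≠ 2 := by
              rintro rfl
              subst hq
              norm_num at hp
            omega
      · refine avg_ge_of_two_mul_le hLle hm5 hN2 (by positivity) ?_
        -- Here `n` is odd and not `1`, so `N * m + 1 ≥ p ^ 3 ≥ 5 * p ^ 2`, well above `2 * p ^ 2 +
        -- 1`.
        have h3 := hpow 3 (by
          obtain ⟨j, rfl⟩ := hno
          omega)
        have hp5' : (5 : ℝ) ≤ p := by exact_mod_cast hp5
        nlinarith [mul_le_mul_of_nonneg_right hp5' (sq_nonneg (p : ℝ))]

/-! ### The `k`-valued linear characters and the number `t`. -/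

section RootOrder

variable (k : Subfield ℂ) {A : Type*} [CommGroup A] [Finite A]

theorem rootOrderLcm_dvd (n : ℕ) : rootOrderLcm k n ∣ n := by
  classical
  exact Finset.lcm_dvd fun _ hd => Nat.dvd_of_mem_divisors (Finset.mem_filter.1 hd).1

theorem pow_rootOrderLcm_eq_one {μ : A →* ℂˣ} (hμ : μ ∈ valuedHoms k A) :
    μ ^ rootOrderLcm k (Nat.card A) = 1 := by
  classical
  ext a
  have h1 : orderOf (μ a : ℂ) ∣ rootOrderLcm k (Nat.card A) := by
    refine Finset.dvd_lcm (f := id) (Finset.mem_filter.2 ⟨Nat.mem_divisors.2 ⟨?_, ?_⟩, _, hμ a, rfl⟩)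
    · change orderOf (μ a : ℂ) ∣ _
      rw [orderOf_units]
      exact (orderOf_map_dvd μ a).trans (orderOf_dvd_natCard a)
    · exact Nat.card_pos.ne'
  simpa using orderOf_dvd_iff_pow_eq_one.1 h1

theorem card_valuedHoms_dvd : Nat.card (valuedHoms k A) ∣ Nat.card A := by
  rw [← CommGroup.card_monoidHom_of_hasEnoughRootsOfUnity A ℂ]
  exact Subgroup.card_subgroup_dvd_card _

theorem prime_dvd_rootOrderLcm {r : ℕ} (hr : r.Prime) (h : r ∣ Nat.card (valuedHoms k A)) :
    r ∣ rootOrderLcm k (Nat.card A) := by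
  have := finite_hom A
  have : Fact r.Prime := ⟨hr⟩
  obtain ⟨μ, hμ⟩ := exists_prime_orderOf_dvd_card' r h
  rw [← hμ, orderOf_dvd_iff_pow_eq_one]
  exact Subtype.ext (pow_rootOrderLcm_eq_one k μ.2)

/-- The dual of a cyclic group is isomorphic to it, so some character has order `|A|`. It is
`k`-valued because all characters are. -/
theorem card_dvd_rootOrderLcm [IsCyclic A] (h : Nat.card (valuedHoms k A) = Nat.card A) :
    Nat.card A ∣ rootOrderLcm k (Nat.card A) := by
  have := finite_hom A
  have htop : valuedHoms k A = ⊤ := Subgroup.eq_top_of_card_eq _ (by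
    rw [h, CommGroup.card_monoidHom_of_hasEnoughRootsOfUnity A ℂ])
  obtain ⟨e⟩ := CommGroup.monoidHom_mulEquiv_of_hasEnoughRootsOfUnity A ℂ
  obtain ⟨a, ha⟩ := IsCyclic.exists_ofOrder_eq_natCard (α := A)
  have h1 : orderOf (e.symm a) ∣ rootOrderLcm k (Nat.card A) := orderOf_dvd_iff_pow_eq_one.2 <|
    pow_rootOrderLcm_eq_one k (htop ▸ Subgroup.mem_top _)
  rwa [e.symm.orderOf_eq, ha] at h1

end RootOrder

/-! ### Consequences of a fixed-point-free action. -/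

section Split

variable {G A : Type*} [Group G] [Finite G] [CommGroup A] {π : G →* A} {s : A →* G}

theorem exists_conj_mul_inv_eq
    {a : A} (ha : ∀ v : π.ker, MulAut.conjNormal (s a) v = v → v = 1) (x : π.ker) :
    ∃ v : π.ker, MulAut.conjNormal (s a) v * v⁻¹ = x := by
  refine Finite.surjective_of_injective
    (f := fun v : π.ker => MulAut.conjNormal (s a) v * v⁻¹) (fun v w h => ?_) x
  have h : MulAut.conjNormal (s a) v * v⁻¹ = MulAut.conjNormal (s a) w * w⁻¹ := h
  refine eq_of_inv_mul_eq_one (a := w) (b := v) (ha _ ?_) |>.symm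
  rw [map_mul, map_inv, inv_mul_eq_iff_eq_mul]
  rw [mul_inv_eq_iff_eq_mul] at h
  rw [h, mul_assoc]

/-- A character fixed by `a` is trivial on all `a v a⁻¹ v⁻¹`, and for `a ≠ 1` these exhaust the
kernel. -/
theorem conjChar_free
    (hfix : ∀ (a : A) (v : π.ker), MulAut.conjNormal (s a) v = v → a = 1 ∨ v = 1)
    (l : π.ker →* ℂˣ) (a : A) (h : conjChar s l a = l) : l = 1 ∨ a = 1 := by
  refine or_iff_not_imp_right.2 fun ha => MonoidHom.ext fun x => ?_
  obtain ⟨v, rfl⟩ := exists_conj_mul_inv_eq (fun v hv => (hfix a v hv).resolve_left ha) x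
  rw [map_mul, map_inv, ← conjChar_apply, h, mul_inv_cancel, MonoidHom.one_apply]

/-- The complement embeds in the automorphism group of a group of prime order, which is cyclic. -/
theorem isCyclic_of_card_ker_prime
    (hfix : ∀ (a : A) (v : π.ker), MulAut.conjNormal (s a) v = v → a = 1 ∨ v = 1)
    (hp : (Nat.card π.ker).Prime) : IsCyclic A := by
  have : Fact (Nat.card π.ker).Prime := ⟨hp⟩
  have : IsCyclic π.ker := isCyclic_of_prime_card rfl
  have : Nontrivial π.ker := Finite.one_lt_card_iff_nontrivial.1 hp.one_lt
  let e := IsCyclic.mulAutMulEquiv π.ker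
  let f : A →* (ZMod (Nat.card π.ker))ˣ := (e.toMonoidHom.comp MulAut.conjNormal).comp s
  refine isCyclic_of_injective f ((injective_iff_map_eq_one f).2 fun a ha => ?_)
  obtain ⟨v, hv⟩ := exists_ne (1 : π.ker)
  have h : MulAut.conjNormal (H := π.ker) (s a) = 1 := by
    apply e.injective
    rw [map_one]
    exact ha
  exact (hfix a v (by rw [h]; rfl)).resolve_right hv

end Split

/-! ### The retraction onto `H` and the Frobenius property. -/

section Complement

variable {G : Type*} [Group G]

theorem exists_retraction {H V : Subgroup G} (hV : V.Normal) (hHV : H ⊔ V = ⊤)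
    (hdisj : H ⊓ V = ⊥) : ∃ π : G →* H, (∀ h : H, π h = h) ∧ π.ker = V := by
  have hc : H.IsComplement' V := Subgroup.isComplement'_of_disjoint_and_mul_eq_univ
    (disjoint_iff.2 hdisj) (by rw [← Subgroup.mul_normal, hHV]; rfl)
  refine ⟨(hc.QuotientMulEquiv : G ⧸ V →* H).comp (QuotientGroup.mk' V), fun h => ?_, ?_⟩
  · exact hc.QuotientMulEquiv.symm.injective (by simp; rfl)
  · ext x
    simp

theorem eq_one_of_fixed {H V : Subgroup G} (hVnormal : V.Normal) (hfaith : ActsFaithfully H V)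
    (hirr : ActsIrreducibly H V) (hHab : ∀ x ∈ H, ∀ y ∈ H, x * y = y * x) {h v : G}
    (hh : h ∈ H) (hv : v ∈ V) (hhv : h * v * h⁻¹ = v) : h = 1 ∨ v = 1 := by
  have hinv : ∀ g ∈ H, ∀ w ∈ V ⊓ Subgroup.centralizer {h},
      g * w * g⁻¹ ∈ V ⊓ Subgroup.centralizer {h} := by
    intro g hg w hw
    rw [Subgroup.mem_inf, Subgroup.mem_centralizer_singleton_iff] at hw
    rw [Subgroup.mem_inf]
    refine ⟨hVnormal.conj_mem w hw.1 g, ?_⟩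
    rw [Subgroup.mem_centralizer_singleton_iff]
    have h2 : Commute h g := hHab h hh g hg
    have h3 : Commute w h := hw.2
    exact ((h2.symm.mul_left h3).mul_left h2.symm.inv_left)
  rcases hirr.2 (V ⊓ Subgroup.centralizer {h}) inf_le_left hinv with h1 | h1
  · right
    rw [← Subgroup.mem_bot, ← h1]
    exact ⟨hv, Subgroup.mem_centralizer_singleton_iff.2 (mul_inv_eq_iff_eq_mul.1 hhv).symm⟩
  · left
    refine hfaith h hh fun w hw => mul_inv_eq_iff_eq_mul.2 ?_
    rw [← h1] at hw
    exact (Subgroup.mem_centralizer_singleton_iff.1 hw.2).symm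

theorem isFrobeniusGroup_of_retraction [Finite G] {H : Subgroup G} (hHne : H ≠ ⊥) (π : G →* H)
    (hπ : ∀ h : H, π h = h) (hVne : π.ker ≠ ⊥) (hHab : ∀ x ∈ H, ∀ y ∈ H, x * y = y * x)
    (hfix : ∀ h ∈ H, ∀ v ∈ π.ker, h * v * h⁻¹ = v → h = 1 ∨ v = 1) :
    IsFrobeniusGroup H π.ker := by
  have hdisj : ∀ x ∈ H, x ∈ π.ker → x = 1 := fun x hx hx' => by
    have := hπ ⟨x, hx⟩
    rw [MonoidHom.mem_ker.1 hx'] at this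
    exact (congrArg Subtype.val this).symm
  refine ⟨hHne, fun h => hVne ?_, fun g hg x hx hgx => ?_, fun x => ⟨fun hx => ?_, fun hx => ?_⟩⟩
  · rw [eq_bot_iff]
    exact fun x hx => Subgroup.mem_bot.2 (hdisj x (h ▸ Subgroup.mem_top x) hx)
  · let h : H := π g
    have hvker : (h : G)⁻¹ * g ∈ π.ker := by simp [MonoidHom.mem_ker, hπ, h]
    have hmem : ((h : G)⁻¹ * g) * x * ((h : G)⁻¹ * g)⁻¹ ∈ H := by
      have := H.mul_mem (H.mul_mem (H.inv_mem h.2) hgx) h.2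
      convert this using 1
      simp [mul_assoc]
    set v := (h : G)⁻¹ * g with hv
    -- Both sides lie in `H`, where `π` is the identity, and `π v = 1`.
    have h1 : v * x * v⁻¹ = x := by
      have h2 := hπ ⟨_, hmem⟩
      have h3 := hπ ⟨x, hx⟩
      simp only [map_mul, map_inv, MonoidHom.mem_ker.1 hvker, one_mul, inv_one, mul_one] at h2 h3
      exact congrArg Subtype.val (h2.symm.trans h3)
    refine (hfix x hx v hvker ?_).resolve_right fun h2 => hg ?_
    · rw [mul_inv_eq_iff_eq_mul] at h1 ⊢
      exact h1.symm
    · rw [← inv_mul_eq_one.1 h2]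
      exact h.2
  · refine or_iff_not_imp_left.2 fun hx1 g hg => hx1 ?_
    have := hdisj _ hg (π.normal_ker.conj_mem x hx g)
    rwa [conj_eq_one_iff] at this
  · rcases hx with rfl | hx
    · exact π.ker.one_mem
    · by_contra hxk
      let _ : CommGroup H := { (inferInstance : Group H) with
        mul_comm := fun a b => Subtype.ext (hHab a a.2 b b.2) }
      have hh1 : ((π x : H) : G) ≠ 1 := fun h => hxk (MonoidHom.mem_ker.2 (Subtype.ext h))
      -- Solving this equation in the kernel yields a conjugate of `x` equal to `π x`, so `x` lies
      -- in a conjugate of `H`.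
      obtain ⟨w, hw⟩ := exists_conj_mul_inv_eq (π := π) (s := H.subtype) (a := π x)
        (fun v hv => Subtype.ext ((hfix _ (π x).2 v v.2 (by
          simpa using congrArg Subtype.val hv)).resolve_left hh1))
        ⟨x⁻¹ * (π x : H), by simp [MonoidHom.mem_ker, hπ]⟩
      have hw' : ((π x : H) : G) * w * ((π x : H) : G)⁻¹ * (w : G)⁻¹ = x⁻¹ * (π x : H) := by
        simpa using congrArg Subtype.val hw
      refine hx ((π x : H) * w : G)⁻¹ ?_
      have hx' : x = (π x : H) * (((π x : H) : G) * w * ((π x : H) : G)⁻¹ * (w : G)⁻¹)⁻¹ := by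
        rw [hw']
        simp
      convert (π x).2 using 1
      nth_rw 2 [hx']
      simp [mul_assoc]

end Complement

end AvgCharDegree

/-! ### The main theorem. -/

open AvgCharDegree in
theorem lemma3p1 {G : Type*} [Group G] [Finite G] (hodd : Odd (Nat.card G))
    (p : ℕ) (hp : p.Prime) (H V : Subgroup G) (hVnormal : V.Normal)
    (hVelem : IsElementaryAbelian p V) (hHV : H ⊔ V = ⊤) (hdisj : H ⊓ V = ⊥)
    (hfaith : ActsFaithfully H V) (hirr : ActsIrreducibly H V)
    (hHne : H ≠ ⊥) (hHab : ∀ x ∈ H, ∀ y ∈ H, x * y = y * x)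
    (k : Subfield ℂ) (hk : ∀ ζ : ℂ, IsPrimitiveRoot ζ p → ζ ∈ k)
    (t : ℕ) (ht : t = rootOrderLcm k (Nat.card H)) :
    IsFrobeniusGroup H V ∧
    (p ≡ 1 [MOD 3] → 3 ∣ t →
      acd k G ≥ 3 * ((p : ℝ) + 2) / ((p : ℝ) + 8)) ∧
    (p ≡ 2 [MOD 3] → ¬ (p - 1) / 2 ∣ t → 3 ∣ t →
      acd k G ≥ 3 * ((p : ℝ) ^ 2 + 2) / ((p : ℝ) ^ 2 + 8)) ∧
    (p ≡ 2 [MOD 3] → (p - 1) / 2 ∣ t →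
      acd k G ≥ 3 * ((p : ℝ) - 1) / ((p : ℝ) + 3)) ∧
    (p ≡ 1 [MOD 3] → ¬ 3 ∣ t →
      acd k G ≥ 3 * (p : ℝ) / ((p : ℝ) + 2)) ∧
    (p ≡ 2 [MOD 3] → ¬ (p - 1) / 2 ∣ t → ¬ 3 ∣ t →
      acd k G ≥ 3 * (p : ℝ) ^ 2 / ((p : ℝ) ^ 2 + 2)) := by
  classical
  have hfix : ∀ h ∈ H, ∀ v ∈ V, h * v * h⁻¹ = v → h = 1 ∨ v = 1 := fun h hh v hv =>
    eq_one_of_fixed hVnormal hfaith hirr hHab hh hv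
  obtain ⟨π, hπ, rfl⟩ := exists_retraction hVnormal hHV hdisj
  have hcomm : ∀ x y : π.ker, x * y = y * x := fun x y =>
    Subtype.ext (hVelem.1 x x.2 y y.2)
  refine ⟨isFrobeniusGroup_of_retraction hHne π hπ hirr.1 hHab hfix, ?_⟩
  let _ : CommGroup H := { (inferInstance : Group H) with
    mul_comm := fun a b => Subtype.ext (hHab a a.2 b b.2) }
  have := Fintype.ofFinite H
  have : Fact p.Prime := ⟨hp⟩
  have hs : ∀ a : H, π (H.subtype a) = a := hπ
  have hfix' : ∀ (a : H) (v : π.ker),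
      MulAut.conjNormal (H.subtype a) v = v → a = 1 ∨ v = 1 := fun a v h => by
    refine (hfix a a.2 v v.2 ?_).imp Subtype.ext Subtype.ext
    simpa using congrArg Subtype.val h
  have hfree := conjChar_free (s := H.subtype) hfix'
  have hcardH : Fintype.card H ≠ 1 := fun h =>
    hHne (Subgroup.card_eq_one.1 (by rw [Nat.card_eq_fintype_card, h]))
  obtain ⟨n, hn⟩ := IsPGroup.iff_card.1 (show IsPGroup p π.ker from fun v =>
    ⟨1, Subtype.ext (by simpa using hVelem.2 v v.2)⟩)
  have hn0 : n ≠ 0 := by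
    rintro rfl
    exact hirr.1 (Subgroup.card_eq_one.1 (by rw [hn, pow_zero]))
  have hpodd : Odd p := by
    refine hodd.of_dvd_nat (dvd_trans ?_ (Subgroup.card_subgroup_dvd_card π.ker))
    rw [hn]
    exact dvd_pow_self p hn0
  have hkl : ∀ (l : π.ker →* ℂˣ) v, (l v : ℂ) ∈ k := fun l v => by
    have hpow : (l v : ℂ) ^ p = 1 := by
      have : v ^ p = 1 := Subtype.ext (hVelem.2 v v.2)
      rw [← Units.val_pow_eq_pow_val, ← map_pow, this, map_one, Units.val_one]
    rcases (Nat.dvd_prime hp).1 (orderOf_dvd_of_pow_eq_one hpow) with h | h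
    · rw [orderOf_eq_one_iff.1 h]
      exact k.one_mem
    · exact hk _ (h ▸ IsPrimitiveRoot.orderOf _)
  rw [acd_eq hs hcomm hfree hcardH k hkl]
  have hcard := Nat.card_eq_fintype_card (α := H)
  refine avg_bounds hp hpodd hn0 ?_ hcardH
    ((ncard_inducedChars_mul hs hcomm hfree).trans hn) ?_ ?_ ?_ ?_
  · rw [← hcard]
    exact hodd.of_dvd_nat (Subgroup.card_subgroup_dvd_card H)
  · rw [← hcard]
    exact card_valuedHoms_dvd k
  · rw [← hcard, ht]
    exact rootOrderLcm_dvd k _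
  · rw [ht]
    exact prime_dvd_rootOrderLcm k Nat.prime_three
  · rintro rfl h
    rw [← hcard] at h ⊢
    have : IsCyclic H := isCyclic_of_card_ker_prime (s := H.subtype) hfix' (by rwa [hn, pow_one])
    rw [ht]
    exact card_dvd_rootOrderLcm k h
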